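/- Let $d\ge 1$, $s\ge 0$, $\alpha>0$. For a real-valued function $g$ on $\mathbb{R}^d$ defining a tempered distribution, let $\hat g$ be its (distributional) Fourier transform, normalised so that $\hat g(\xi)=(2\pi)^{-d}\int_{\mathbb{R}^d} g(x)e^{-i x\cdot\xi}\,dx$ for $g\in L^1(\mathbb{R}^d)$. Let $\mathcal{B}^s(\mathbb{R}^d)$ be the space of real-valued functions $g$ on $\mathbb{R}^d$, modulo equality almost everywhere, whose Fourier transform $\hat g$ is a function with $$\int_{\mathbb{R}^d}|\hat g(\xi)|\,(1+|\xi|^2)^{s/2}\,d\xi<\infty .$$ Let $W\in\mathcal{B}^s(\mathbb{R}^d)$, and let $V:\mathbb{R}^d\to\mathbb{R}$ satisfy $V(x)\ge 0$ for all $x$ and $V=\alpha+W$ (almost everywhere). For $u\in\mathcal{B}^s(\mathbb{R}^d)$ put $\mathcal{T}_{\alpha,W}(u)=(\alpha-\Delta)^{-1}(Wu)$, where $(\alpha-\Delta)^{-1}g$ is the inverse Fourier transform $x\mapsto\int_{\mathbb{R}^d}\frac{\hat g(\xi)}{\alpha+|\xi|^2}e^{i x\cdot\xi}\,d\xi$.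 Then $I+\mathcal{T}_{\alpha,W}$ maps $\mathcal{B}^s(\mathbb{R}^d)$ into $\mathcal{B}^s(\mathbb{R}^d)$ and is injective on $\mathcal{B}^s(\mathbb{R}^d)$. Moreover, the only $u\in\mathcal{B}^s(\mathbb{R}^d)$ satisfying $-\Delta u+Vu=0$ in the sense of tempered distributions is $u=0$. -/

import Mathlib

open MeasureTheory Set
open scoped SchwartzMap Laplacian

/-- The Fourier transform of an integrable function, normalised by `(2π)^{-d}`:
`ĝ(ξ) = (2π)^{-d} ∫ g(x) e^{-i x·ξ} dx`. -/
noncomputable def fourierIntegralFun {d : ℕ} (g : EuclideanSpace ℝ (Fin d) → ℂ)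
    (ξ : EuclideanSpace ℝ (Fin d)) : ℂ :=
  ((2 * Real.pi : ℝ) ^ d : ℂ)⁻¹ * ∫ x, g x * Complex.exp (-Complex.I * (inner ℝ x ξ : ℝ))

/-- The inverse Fourier integral `x ↦ ∫ h(ξ) e^{i x·ξ} dξ`. -/
noncomputable def fourierInvIntegralFun {d : ℕ} (h : EuclideanSpace ℝ (Fin d) → ℂ)
    (x : EuclideanSpace ℝ (Fin d)) : ℂ :=
  ∫ ξ, h ξ * Complex.exp (Complex.I * (inner ℝ x ξ : ℝ))

/-- The real-valued function `g` defines a tempered distribution, and the Fourier transform of that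
tempered distribution is given by the function `h`: for every Schwartz function `φ`,
`∫ g φ̂ = ∫ h φ`. -/
structure IsFourierTransform {d : ℕ} (g : EuclideanSpace ℝ (Fin d) → ℝ)
    (h : EuclideanSpace ℝ (Fin d) → ℂ) : Prop where
  aestronglyMeasurable : AEStronglyMeasurable h volume
  integrable_left : ∀ φ : 𝓢(EuclideanSpace ℝ (Fin d), ℂ), Integrable fun x => (g x : ℂ) * φ x
  integrable_right : ∀ φ : 𝓢(EuclideanSpace ℝ (Fin d), ℂ), Integrable fun ξ => h ξ * φ ξ
  pairing : ∀ φ : 𝓢(EuclideanSpace ℝ (Fin d), ℂ),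
    ∫ x, (g x : ℂ) * fourierIntegralFun φ x = ∫ ξ, h ξ * φ ξ

open Classical in
/-- A function `ĝ` representing the distributional Fourier transform of `g` (it is unique up to
null sets); zero if the Fourier transform of `g` is not a function. -/
noncomputable def fourierTransformFun {d : ℕ} (g : EuclideanSpace ℝ (Fin d) → ℝ) :
    EuclideanSpace ℝ (Fin d) → ℂ :=
  if hg : ∃ h, IsFourierTransform g h then hg.choose else 0

/-- The spectral Barron space `𝓑^s(ℝ^d)`: the real-valued functions `g` (up to a.e. equality) whose
Fourier transform is a function `ĝ` with `∫ |ĝ(ξ)| (1 + |ξ|²)^{s/2} dξ < ∞`. -/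
def spectralBarronSpace (d : ℕ) (s : ℝ) : Set (EuclideanSpace ℝ (Fin d) →ₘ[volume] ℝ) :=
  {g | ∃ h : EuclideanSpace ℝ (Fin d) → ℂ, IsFourierTransform g h ∧
    Integrable fun ξ => ‖h ξ‖ * (1 + ‖ξ‖ ^ 2) ^ (s / 2)}

/-- `(α - Δ)⁻¹ g`, the inverse Fourier transform of `ĝ(ξ) / (α + |ξ|²)`.  For real-valued `g` this
inverse Fourier transform is real-valued; the real part only turns its values, which are complex
numbers with vanishing imaginary part, into real numbers. -/
noncomputable def resolventFun {d : ℕ} (α : ℝ) (g : EuclideanSpace ℝ (Fin d) → ℝ)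
    (x : EuclideanSpace ℝ (Fin d)) : ℝ :=
  (fourierInvIntegralFun (fun ξ => fourierTransformFun g ξ / ((α + ‖ξ‖ ^ 2 : ℝ) : ℂ)) x).re

theorem aestronglyMeasurable_fourierTransformFun {d : ℕ} (g : EuclideanSpace ℝ (Fin d) → ℝ) :
    AEStronglyMeasurable (fourierTransformFun g) volume := by
  unfold fourierTransformFun
  split_ifs with hg
  · exact hg.choose_spec.aestronglyMeasurable
  · exact aestronglyMeasurable_const

theorem aestronglyMeasurable_resolventFun {d : ℕ} (α : ℝ) (g : EuclideanSpace ℝ (Fin d) → ℝ) :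
    AEStronglyMeasurable (resolventFun α g) volume := by
  refine Complex.continuous_re.comp_aestronglyMeasurable ?_
  have h1 : AEStronglyMeasurable
      (fun ξ => fourierTransformFun g ξ / ((α + ‖ξ‖ ^ 2 : ℝ) : ℂ)) volume :=
    ((aestronglyMeasurable_fourierTransformFun g).aemeasurable.div
      (by fun_prop)).aestronglyMeasurable
  have h2 : AEStronglyMeasurable
      (fun p : EuclideanSpace ℝ (Fin d) × EuclideanSpace ℝ (Fin d) =>
        (fourierTransformFun g p.2 / ((α + ‖p.2‖ ^ 2 : ℝ) : ℂ)) *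
          Complex.exp (Complex.I * (inner ℝ p.1 p.2 : ℝ)))
      (volume.prod volume) :=
    h1.comp_snd.mul (by fun_prop : Continuous _).aestronglyMeasurable
  exact h2.integral_prod_right'

/-- The operator `(α - Δ)⁻¹` on (classes of) functions. -/
noncomputable def barronResolvent {d : ℕ} (α : ℝ) (g : EuclideanSpace ℝ (Fin d) →ₘ[volume] ℝ) :
    EuclideanSpace ℝ (Fin d) →ₘ[volume] ℝ :=
  AEEqFun.mk (resolventFun α g) (aestronglyMeasurable_resolventFun α g)

/-- The operator `𝓣_{α,W}(u) = (α - Δ)⁻¹ (W u)`. -/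
noncomputable def barronOperator {d : ℕ} (α : ℝ) (W u : EuclideanSpace ℝ (Fin d) →ₘ[volume] ℝ) :
    EuclideanSpace ℝ (Fin d) →ₘ[volume] ℝ :=
  barronResolvent α (W * u)

/-- `-Δu + V u = 0` in the sense of (tempered) distributions on `ℝ^d`. -/
def IsDistributionalSolution {d : ℕ} (V u : EuclideanSpace ℝ (Fin d) → ℝ) : Prop :=
  ∀ φ : 𝓢(EuclideanSpace ℝ (Fin d), ℝ), -(∫ x, u x * (Δ φ) x) + ∫ x, V x * u x * φ x = 0

/-! Let h and w be the transforms of u and W. Since s ≥ 0, both are integrable, so u and W are a.e.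
inverse Fourier integrals (`isFourierTransform_iff`) and Wu has transform w ⋆ h
(`isFourierTransform_mul`). Stability of the Barron space follows from Peetre's inequality and the
integrability of convolutions, division by α + |ξ|² being a bounded multiplier.

Both uniqueness claims reduce to one equation, (α + |ξ|²) h + w ⋆ h = 0 a.e. For injectivity, h is
the difference of two transforms; for distributional solutions, the equation comes from testing
(`fourier_equation_of_isDistributionalSolution`). It forces |ξ|² h to be integrable. Hence U, the
real part of the inverse Fourier integral of h, is continuous, tends to 0 at infinity by
Riemann–Lebesgue, and has second symmetric derivatives along the axes whose sum is VU, with V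
replaced by its continuous representative. This sum is nonnegative where U > 0, so a maximum
principle (`nonpos_of_sum_second_symmetric_deriv_nonneg`) gives U ≤ 0; the same argument for -h
gives U = 0. Decay at infinity takes the place of an energy estimate, as u need not be square
integrable. -/

open scoped FourierTransform Convolution
open Filter Topology

/-! ### Inverse Fourier integrals of integrable functions -/

section FourierInverse

variable {d : ℕ} {h k : EuclideanSpace ℝ (Fin d) → ℂ}

theorem fourierInvIntegralFun_eq_fourierInv (h : EuclideanSpace ℝ (Fin d) → ℂ)
    (x : EuclideanSpace ℝ (Fin d)) :
    fourierInvIntegralFun h x = 𝓕⁻ h ((2 * Real.pi)⁻¹ • x) := by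
  rw [Real.fourierInv_eq', fourierInvIntegralFun]
  congr 1 with ξ
  rw [inner_smul_right, real_inner_comm, smul_eq_mul, mul_comm (h ξ)]
  congr 2
  have : (Real.pi : ℂ) ≠ 0 := by exact_mod_cast Real.pi_ne_zero
  push_cast
  field_simp

theorem fourierIntegralFun_eq_fourier (g : EuclideanSpace ℝ (Fin d) → ℂ)
    (ξ : EuclideanSpace ℝ (Fin d)) :
    fourierIntegralFun g ξ =
      ((2 * Real.pi : ℝ) ^ d : ℂ)⁻¹ * 𝓕 g ((2 * Real.pi)⁻¹ • ξ) := by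
  rw [Real.fourier_eq', fourierIntegralFun]
  congr 2 with x
  rw [inner_smul_right, smul_eq_mul, mul_comm (g x)]
  congr 2
  have : (Real.pi : ℂ) ≠ 0 := by exact_mod_cast Real.pi_ne_zero
  push_cast
  field_simp

theorem fourierInvIntegralFun_congr_ae (hhk : h =ᵐ[volume] k) :
    fourierInvIntegralFun h = fourierInvIntegralFun k := by
  ext x
  refine integral_congr_ae ?_
  filter_upwards [hhk] with ξ hξ
  rw [hξ]

theorem norm_exp_I_mul_inner (x ξ : EuclideanSpace ℝ (Fin d)) :
    ‖Complex.exp (Complex.I * (inner ℝ x ξ : ℝ))‖ = 1 := by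
  rw [mul_comm]
  exact Complex.norm_exp_ofReal_mul_I _

theorem integrable_mul_exp_inner (hh : Integrable h) (x : EuclideanSpace ℝ (Fin d)) :
    Integrable fun ξ => h ξ * Complex.exp (Complex.I * (inner ℝ x ξ : ℝ)) := by
  refine hh.mul_bdd (c := 1) (by fun_prop : Continuous _).aestronglyMeasurable ?_
  exact Eventually.of_forall fun ξ => (norm_exp_I_mul_inner x ξ).le

theorem continuous_fourierInvIntegralFun (hh : Integrable h) :
    Continuous (fourierInvIntegralFun h) := by
  refine continuous_of_dominated (bound := fun ξ => ‖h ξ‖) ?_ ?_ hh.norm ?_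
  · exact fun x => (integrable_mul_exp_inner hh x).aestronglyMeasurable
  · intro x
    refine Eventually.of_forall fun ξ => ?_
    rw [norm_mul, norm_exp_I_mul_inner, mul_one]
  · exact Eventually.of_forall fun ξ => by fun_prop

theorem norm_fourierInvIntegralFun_le (h : EuclideanSpace ℝ (Fin d) → ℂ)
    (x : EuclideanSpace ℝ (Fin d)) : ‖fourierInvIntegralFun h x‖ ≤ ∫ ξ, ‖h ξ‖ := by
  refine (norm_integral_le_integral_norm _).trans_eq ?_
  simp_rw [norm_mul, norm_exp_I_mul_inner, mul_one]

theorem tendsto_fourierInvIntegralFun_cocompact (h : EuclideanSpace ℝ (Fin d) → ℂ) :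
    Tendsto (fourierInvIntegralFun h) (cocompact (EuclideanSpace ℝ (Fin d))) (𝓝 0) := by
  have h1 := tendsto_integral_exp_inner_smul_cocompact h
  -- This dilation turns the kernel of Mathlib's Riemann–Lebesgue lemma, e^{-2πi⟨ξ,y⟩}, into e^{i
  -- x·ξ}.
  have hc : (-(2 * Real.pi)⁻¹ : ℝ) ≠ 0 := by simp [Real.pi_ne_zero]
  have h2 := h1.comp (Homeomorph.smulOfNeZero (α := EuclideanSpace ℝ (Fin d)) _
    hc).isClosedEmbedding.tendsto_cocompact
  refine h2.congr fun x => ?_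
  rw [fourierInvIntegralFun_eq_fourierInv, Real.fourierInv_eq_fourier_neg, Real.fourier_eq]
  simp

theorem fourierInvIntegralFun_add (hh : Integrable h) (hk : Integrable k)
    (x : EuclideanSpace ℝ (Fin d)) : fourierInvIntegralFun (fun ξ => h ξ + k ξ) x =
      fourierInvIntegralFun h x + fourierInvIntegralFun k x := by
  simp only [fourierInvIntegralFun, add_mul]
  exact integral_add (integrable_mul_exp_inner hh x) (integrable_mul_exp_inner hk x)

theorem fourierInvIntegralFun_const_mul (c : ℂ) (h : EuclideanSpace ℝ (Fin d) → ℂ)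
    (x : EuclideanSpace ℝ (Fin d)) : fourierInvIntegralFun (fun ξ => c * h ξ) x =
      c * fourierInvIntegralFun h x := by
  simp only [fourierInvIntegralFun, mul_assoc]
  exact integral_const_mul _ _

theorem fourierInvIntegralFun_sub (hh : Integrable h) (hk : Integrable k)
    (x : EuclideanSpace ℝ (Fin d)) : fourierInvIntegralFun (fun ξ => h ξ - k ξ) x =
      fourierInvIntegralFun h x - fourierInvIntegralFun k x := by
  simp only [fourierInvIntegralFun, sub_mul]
  exact integral_sub (integrable_mul_exp_inner hh x) (integrable_mul_exp_inner hk x)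

theorem fourierInvIntegralFun_convolution (hh : Integrable h) (hk : Integrable k)
    (x : EuclideanSpace ℝ (Fin d)) :
    fourierInvIntegralFun (h ⋆[ContinuousLinearMap.mul ℂ ℂ] k) x =
      fourierInvIntegralFun h x * fourierInvIntegralFun k x := by
  simp only [fourierInvIntegralFun_eq_fourierInv, Real.fourierInv_eq_fourier_neg]
  exact Real.fourier_mul_convolution_eq hh hk _

theorem fourierInvIntegralFun_conj_neg (h : EuclideanSpace ℝ (Fin d) → ℂ)
    (x : EuclideanSpace ℝ (Fin d)) :
    fourierInvIntegralFun (fun ξ => starRingEnd ℂ (h (-ξ))) x =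
      starRingEnd ℂ (fourierInvIntegralFun h x) := by
  rw [fourierInvIntegralFun, fourierInvIntegralFun, ← integral_conj, ← integral_neg_eq_self]
  congr 1 with ξ
  rw [map_mul, ← Complex.exp_conj, map_mul, Complex.conj_I, Complex.conj_ofReal, neg_neg,
    inner_neg_right]
  push_cast
  ring_nf

/-- Fubini: `∫ ȟ k = ∫ h ǩ`. -/
theorem integral_fourierInvIntegralFun_mul (hh : Integrable h) (hk : Integrable k) :
    ∫ x, fourierInvIntegralFun h x * k x = ∫ ξ, h ξ * fourierInvIntegralFun k ξ := by
  simp only [fourierInvIntegralFun, ← integral_mul_const, ← integral_const_mul]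
  rw [integral_integral_swap]
  · congr 1 with ξ
    congr 1 with x
    rw [real_inner_comm]
    ring
  · have h1 : Integrable (fun p : EuclideanSpace ℝ (Fin d) × EuclideanSpace ℝ (Fin d) =>
        (k p.1 * h p.2) * Complex.exp (Complex.I * (inner ℝ p.1 p.2 : ℝ)))
        (volume.prod volume) := by
      refine (hk.mul_prod hh).mul_bdd (c := 1)
        (by fun_prop : Continuous _).aestronglyMeasurable ?_
      exact Eventually.of_forall fun p => (norm_exp_I_mul_inner p.1 p.2).le
    refine h1.congr (Eventually.of_forall fun p => ?_)
    simp only [Function.uncurry]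
    ring

end FourierInverse

/-! ### Fourier inversion and the Laplacian on Schwartz functions -/

section Schwartz

variable {d : ℕ}

/-- Dilation of the variable as an operator on Schwartz functions. -/
noncomputable def schwartzDilation (d : ℕ) (c : ℝ) (hc : c ≠ 0) :
    𝓢(EuclideanSpace ℝ (Fin d), ℂ) →L[ℂ] 𝓢(EuclideanSpace ℝ (Fin d), ℂ) :=
  SchwartzMap.compCLMOfContinuousLinearEquiv ℂ
    (ContinuousLinearEquiv.smulLeft (Units.mk0 c hc))

theorem schwartzDilation_apply (c : ℝ) (hc : c ≠ 0) (φ : 𝓢(EuclideanSpace ℝ (Fin d), ℂ))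
    (x : EuclideanSpace ℝ (Fin d)) : schwartzDilation d c hc φ x = φ (c • x) := rfl

/-- The inverse Fourier integral of a Schwartz function, as a Schwartz function. -/
theorem exists_schwartz_fourierInvIntegralFun (φ : 𝓢(EuclideanSpace ℝ (Fin d), ℂ)) :
    ∃ ψ : 𝓢(EuclideanSpace ℝ (Fin d), ℂ), ∀ ξ, ψ ξ = fourierInvIntegralFun φ ξ := by
  refine ⟨schwartzDilation d (2 * Real.pi)⁻¹ (by simp [Real.pi_ne_zero]) (𝓕⁻ φ), fun ξ => ?_⟩
  rw [schwartzDilation_apply, fourierInvIntegralFun_eq_fourierInv, SchwartzMap.fourierInv_coe]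

/-- The Fourier integral of a Schwartz function, as a Schwartz function. -/
theorem exists_schwartz_fourierIntegralFun (φ : 𝓢(EuclideanSpace ℝ (Fin d), ℂ)) :
    ∃ ψ : 𝓢(EuclideanSpace ℝ (Fin d), ℂ), ∀ ξ, ψ ξ = fourierIntegralFun φ ξ := by
  refine ⟨((2 * Real.pi : ℝ) ^ d : ℂ)⁻¹ •
    schwartzDilation d (2 * Real.pi)⁻¹ (by simp [Real.pi_ne_zero]) (𝓕 φ), fun ξ => ?_⟩
  rw [smul_apply, schwartzDilation_apply, fourierIntegralFun_eq_fourier,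
    SchwartzMap.fourier_coe, smul_eq_mul]

/-- Mathlib's inversion formula after the substitution ξ ↦ (2π)⁻¹ξ, whose Jacobian is compensated by
the normalising factor (2π)^{-d}. -/
theorem fourierInvIntegralFun_fourierIntegralFun (φ : 𝓢(EuclideanSpace ℝ (Fin d), ℂ))
    (x : EuclideanSpace ℝ (Fin d)) : fourierInvIntegralFun (fourierIntegralFun φ) x = φ x := by
  have hpi : (0 : ℝ) < 2 * Real.pi := by positivity
  have h1 : 𝓕⁻ (𝓕 (φ : EuclideanSpace ℝ (Fin d) → ℂ)) x = φ x := by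
    rw [← SchwartzMap.fourier_coe, ← SchwartzMap.fourierInv_coe,
      FourierTransform.fourierInv_fourier_eq]
  have h2 := Measure.integral_comp_smul (volume : Measure (EuclideanSpace ℝ (Fin d)))
    (fun w => Complex.exp (↑(2 * Real.pi * inner ℝ w x) * Complex.I) •
      𝓕 (φ : EuclideanSpace ℝ (Fin d) → ℂ) w) (2 * Real.pi)⁻¹
  rw [← Real.fourierInv_eq', h1] at h2
  simp only [fourierInvIntegralFun, fourierIntegralFun_eq_fourier, mul_assoc]
  rw [integral_const_mul, inv_mul_eq_iff_eq_mul₀ (by exact_mod_cast (pow_pos hpi d).ne')]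
  have h3 : ((2 * Real.pi : ℝ) ^ d : ℂ) * φ x =
      |(((2 * Real.pi)⁻¹ : ℝ) ^ Module.finrank ℝ (EuclideanSpace ℝ (Fin d)))⁻¹| • φ x := by
    rw [finrank_euclideanSpace_fin, inv_pow, inv_inv, abs_of_pos (pow_pos hpi d)]
    simp
  rw [h3, ← h2]
  congr 1 with ξ
  rw [smul_eq_mul, mul_comm]
  congr 2
  rw [real_inner_smul_left, real_inner_comm]
  have : (Real.pi : ℂ) ≠ 0 := by exact_mod_cast Real.pi_ne_zero
  push_cast
  field_simp

theorem fourierIntegralFun_fourierInvIntegralFun (φ : 𝓢(EuclideanSpace ℝ (Fin d), ℂ))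
    (x : EuclideanSpace ℝ (Fin d)) : fourierIntegralFun (fourierInvIntegralFun φ) x = φ x := by
  -- The two transforms differ by a constant and a reflection, so the other order of inversion is a
  -- consequence of the first.
  have h1 (f : EuclideanSpace ℝ (Fin d) → ℂ) (y : EuclideanSpace ℝ (Fin d)) :
      fourierIntegralFun f y = ((2 * Real.pi : ℝ) ^ d : ℂ)⁻¹ * fourierInvIntegralFun f (-y) := by
    rw [fourierIntegralFun_eq_fourier, fourierInvIntegralFun_eq_fourierInv,
      Real.fourierInv_eq_fourier_neg, smul_neg, neg_neg]
  have h2 := fourierInvIntegralFun_fourierIntegralFun φ x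
  rw [funext (h1 φ), fourierInvIntegralFun_const_mul] at h2
  rw [h1, ← h2, fourierInvIntegralFun, fourierInvIntegralFun, ← integral_neg_eq_self]
  simp

theorem fourierInvIntegralFun_laplacian (φ : 𝓢(EuclideanSpace ℝ (Fin d), ℂ))
    (ξ : EuclideanSpace ℝ (Fin d)) :
    fourierInvIntegralFun (Δ φ : 𝓢(EuclideanSpace ℝ (Fin d), ℂ)) ξ =
      -(‖ξ‖ ^ 2 : ℝ) * fourierInvIntegralFun φ ξ := by
  have hg : (fun x : EuclideanSpace ℝ (Fin d) => ‖x‖ ^ 2).HasTemperateGrowth := by fun_prop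
  have h1 : 𝓕 (Δ φ) = -(2 * Real.pi) ^ 2 • SchwartzMap.smulLeftCLM ℂ
      (fun x : EuclideanSpace ℝ (Fin d) => ‖x‖ ^ 2) (𝓕 φ) := by
    rw [SchwartzMap.laplacian_eq_fourierMultiplierCLM, FourierTransform.fourier_smul,
      SchwartzMap.fourierMultiplierCLM_apply, FourierTransform.fourier_fourierInv_eq]
  have h2 (ψ : 𝓢(EuclideanSpace ℝ (Fin d), ℂ)) :
      fourierInvIntegralFun ψ ξ = (𝓕 ψ) (-((2 * Real.pi)⁻¹ • ξ)) := by
    rw [fourierInvIntegralFun_eq_fourierInv, Real.fourierInv_eq_fourier_neg,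
      SchwartzMap.fourier_coe]
  rw [h2, h2, h1, smul_apply, SchwartzMap.smulLeftCLM_apply_apply hg, norm_neg,
    norm_smul, smul_smul, Complex.real_smul]
  congr 1
  have : (Real.pi : ℂ) ≠ 0 := by exact_mod_cast Real.pi_ne_zero
  rw [Real.norm_of_nonneg (by positivity)]
  push_cast
  field_simp

end Schwartz

/-! ### Distributional transforms versus inverse Fourier integrals -/

section Characterisation

variable {d : ℕ}

/-- Two functions which define the same tempered distribution agree almost everywhere. -/
theorem ae_eq_of_forall_integral_mul_schwartz_eq {f g : EuclideanSpace ℝ (Fin d) → ℂ}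
    (hf : ∀ φ : 𝓢(EuclideanSpace ℝ (Fin d), ℂ), Integrable fun x => f x * φ x)
    (hg : ∀ φ : 𝓢(EuclideanSpace ℝ (Fin d), ℂ), Integrable fun x => g x * φ x)
    (hfg : ∀ φ : 𝓢(EuclideanSpace ℝ (Fin d), ℂ), ∫ x, f x * φ x = ∫ x, g x * φ x) :
    f =ᵐ[volume] g := by
  have hloc (f : EuclideanSpace ℝ (Fin d) → ℂ)
      (hf : ∀ φ : 𝓢(EuclideanSpace ℝ (Fin d), ℂ), Integrable fun x => f x * φ x) :
      LocallyIntegrable f := by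
    intro x
    -- Testing against a bump equal to 1 near x recovers local integrability there.
    let b : ContDiffBump x := default
    let φ : 𝓢(EuclideanSpace ℝ (Fin d), ℂ) :=
      (b.hasCompactSupport.comp_left (g := Complex.ofReal) Complex.ofReal_zero).toSchwartzMap
        (Complex.ofRealCLM.contDiff.comp b.contDiff)
    refine ⟨Metric.closedBall x b.rIn, Metric.closedBall_mem_nhds x b.rIn_pos, ?_⟩
    refine ((hf φ).integrableOn (s := Metric.closedBall x b.rIn)).congr_fun (fun y hy => ?_)
      measurableSet_closedBall
    have : φ y = (b y : ℂ) := rfl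
    simp only [this, b.one_of_mem_closedBall hy, Complex.ofReal_one, mul_one]
  refine ae_eq_of_integral_contDiff_smul_eq (hloc f hf) (hloc g hg) fun ψ hψ hc => ?_
  simp only [Complex.real_smul, mul_comm (Complex.ofReal _)]
  exact hfg ((hc.comp_left (g := Complex.ofReal) Complex.ofReal_zero).toSchwartzMap
        (Complex.ofRealCLM.contDiff.comp hψ))

theorem IsFourierTransform.ae_eq {g : EuclideanSpace ℝ (Fin d) → ℝ}
    {h k : EuclideanSpace ℝ (Fin d) → ℂ} (hh : IsFourierTransform g h)
    (hk : IsFourierTransform g k) : h =ᵐ[volume] k :=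
  ae_eq_of_forall_integral_mul_schwartz_eq hh.integrable_right hk.integrable_right
    fun φ => (hh.pairing φ).symm.trans (hk.pairing φ)

theorem integrable_mul_schwartz {h : EuclideanSpace ℝ (Fin d) → ℂ} (hh : Integrable h)
    (φ : 𝓢(EuclideanSpace ℝ (Fin d), ℂ)) : Integrable fun ξ => h ξ * φ ξ :=
  hh.mul_bdd (c := ‖φ.toBoundedContinuousFunction‖) φ.continuous.aestronglyMeasurable
    (Eventually.of_forall fun ξ => φ.toBoundedContinuousFunction.norm_coe_le_norm ξ)

theorem integrable_fourierInvIntegralFun_mul {h φ : EuclideanSpace ℝ (Fin d) → ℂ}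
    (hh : Integrable h) (hφ : Integrable φ) :
    Integrable fun x => fourierInvIntegralFun h x * φ x :=
  hφ.bdd_mul (continuous_fourierInvIntegralFun hh).aestronglyMeasurable
    (Eventually.of_forall fun x => norm_fourierInvIntegralFun_le h x)

/-- For integrable `h`, the distributional Fourier transform of `g` is `h` iff `g` is almost
everywhere the inverse Fourier integral of `h`. -/
theorem isFourierTransform_iff {g : EuclideanSpace ℝ (Fin d) → ℝ}
    {h : EuclideanSpace ℝ (Fin d) → ℂ} (hh : Integrable h) :
    IsFourierTransform g h ↔ (fun x => (g x : ℂ)) =ᵐ[volume] fourierInvIntegralFun h := by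
  constructor
  · intro H
    refine ae_eq_of_forall_integral_mul_schwartz_eq H.integrable_left
      (fun φ => integrable_fourierInvIntegralFun_mul hh φ.integrable) fun φ => ?_
    -- The pairing only sees transforms of test functions; every φ is one, namely that of its
    -- inverse transform ψ.
    obtain ⟨ψ, hψ⟩ := exists_schwartz_fourierInvIntegralFun φ
    have h1 := H.pairing ψ
    rw [funext hψ] at h1
    simp only [fourierIntegralFun_fourierInvIntegralFun] at h1
    rw [h1, integral_fourierInvIntegralFun_mul hh φ.integrable]
  · intro H
    refine ⟨hh.aestronglyMeasurable, fun φ => ?_, integrable_mul_schwartz hh, fun φ => ?_⟩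
    · refine (integrable_fourierInvIntegralFun_mul hh φ.integrable).congr ?_
      filter_upwards [H] with x hx
      rw [hx]
    · obtain ⟨ψ, hψ⟩ := exists_schwartz_fourierIntegralFun φ
      have h1 : ∫ x, (g x : ℂ) * fourierIntegralFun φ x =
          ∫ x, fourierInvIntegralFun h x * ψ x := by
        refine integral_congr_ae ?_
        filter_upwards [H] with x hx
        rw [hx, hψ]
      rw [h1, integral_fourierInvIntegralFun_mul hh ψ.integrable, funext hψ]
      simp only [fourierInvIntegralFun_fourierIntegralFun]

/-- Makes the choice inside `fourierTransformFun` harmless: any known transform may be substituted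
under an integral. -/
theorem fourierTransformFun_ae_eq {g : EuclideanSpace ℝ (Fin d) → ℝ}
    {h : EuclideanSpace ℝ (Fin d) → ℂ} (H : IsFourierTransform g h) :
    fourierTransformFun g =ᵐ[volume] h := by
  have hg : ∃ h, IsFourierTransform g h := ⟨h, H⟩
  rw [fourierTransformFun, dif_pos hg]
  exact hg.choose_spec.ae_eq H

/-- The inverse Fourier integral is injective on integrable functions. -/
theorem ae_eq_of_fourierInvIntegralFun_eq {h k : EuclideanSpace ℝ (Fin d) → ℂ}
    (hh : Integrable h) (hk : Integrable k)
    (hhk : fourierInvIntegralFun h =ᵐ[volume] fourierInvIntegralFun k) : h =ᵐ[volume] k := by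
  refine ae_eq_of_forall_integral_mul_schwartz_eq (integrable_mul_schwartz hh)
    (integrable_mul_schwartz hk) fun φ => ?_
  obtain ⟨ψ, hψ⟩ := exists_schwartz_fourierIntegralFun φ
  have h1 {f : EuclideanSpace ℝ (Fin d) → ℂ} (hf : Integrable f) :
      ∫ x, fourierInvIntegralFun f x * ψ x = ∫ ξ, f ξ * φ ξ := by
    rw [integral_fourierInvIntegralFun_mul hf ψ.integrable, funext hψ]
    simp only [fourierInvIntegralFun_fourierIntegralFun]
  rw [← h1 hh, ← h1 hk]
  refine integral_congr_ae ?_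
  filter_upwards [hhk] with x hx
  rw [hx]

/-- Both sides have the same inverse integral because g is real, and that integral is injective.
This symmetry is what makes inverse integrals real at every point, not merely almost everywhere. -/
theorem IsFourierTransform.conj_neg_ae_eq {g : EuclideanSpace ℝ (Fin d) → ℝ}
    {h : EuclideanSpace ℝ (Fin d) → ℂ} (H : IsFourierTransform g h) (hh : Integrable h) :
    (fun ξ => starRingEnd ℂ (h (-ξ))) =ᵐ[volume] h := by
  have h1 : Integrable fun ξ => starRingEnd ℂ (h (-ξ)) :=
    (Complex.conjLIE.toContinuousLinearEquiv.integrable_comp_iff).2 hh.comp_neg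
  refine ae_eq_of_fourierInvIntegralFun_eq h1 hh ?_
  filter_upwards [(isFourierTransform_iff hh).1 H] with x hx
  rw [fourierInvIntegralFun_conj_neg, ← hx, Complex.conj_ofReal]

theorem fourierInvIntegralFun_im_eq_zero {h : EuclideanSpace ℝ (Fin d) → ℂ}
    (hh : (fun ξ => starRingEnd ℂ (h (-ξ))) =ᵐ[volume] h) (x : EuclideanSpace ℝ (Fin d)) :
    (fourierInvIntegralFun h x).im = 0 := by
  rw [← Complex.conj_eq_iff_im, ← fourierInvIntegralFun_conj_neg,
    fourierInvIntegralFun_congr_ae hh]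

theorem ofReal_re_fourierInvIntegralFun {h : EuclideanSpace ℝ (Fin d) → ℂ}
    (hh : (fun ξ => starRingEnd ℂ (h (-ξ))) =ᵐ[volume] h) (x : EuclideanSpace ℝ (Fin d)) :
    ((fourierInvIntegralFun h x).re : ℂ) = fourierInvIntegralFun h x :=
  Complex.ext rfl (by simp [fourierInvIntegralFun_im_eq_zero hh x])

end Characterisation

/-! ### The Barron weight and convolution -/

section Weight

variable {d : ℕ} {s : ℝ} {h k : EuclideanSpace ℝ (Fin d) → ℂ}

theorem one_le_one_add_norm_sq_rpow (hs : 0 ≤ s) (ξ : EuclideanSpace ℝ (Fin d)) :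
    1 ≤ (1 + ‖ξ‖ ^ 2) ^ (s / 2) :=
  Real.one_le_rpow (by nlinarith [sq_nonneg ‖ξ‖]) (by positivity)

theorem integrable_of_integrable_norm_mul_rpow (hs : 0 ≤ s) (hm : AEStronglyMeasurable h)
    (hh : Integrable fun ξ => ‖h ξ‖ * (1 + ‖ξ‖ ^ 2) ^ (s / 2)) : Integrable h := by
  refine hh.mono' hm (Eventually.of_forall fun ξ => ?_)
  exact le_mul_of_one_le_right (norm_nonneg _) (one_le_one_add_norm_sq_rpow hs ξ)

/-- Peetre's inequality. -/
theorem one_add_norm_sq_rpow_le (hs : 0 ≤ s) (ξ η : EuclideanSpace ℝ (Fin d)) :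
    (1 + ‖ξ‖ ^ 2) ^ (s / 2) ≤
      2 ^ (s / 2) * ((1 + ‖η‖ ^ 2) ^ (s / 2) * (1 + ‖ξ - η‖ ^ 2) ^ (s / 2)) := by
  rw [← Real.mul_rpow (by positivity) (by positivity),
    ← Real.mul_rpow (by positivity) (by positivity)]
  refine Real.rpow_le_rpow (by positivity) ?_ (by positivity)
  -- The base inequality is 1 + |ξ|² ≤ 2(1 + |η|²)(1 + |ξ - η|²), from (a + b)² ≤ 2a² + 2b².
  have h1 : ‖ξ‖ ≤ ‖η‖ + ‖ξ - η‖ := by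
    simpa using norm_add_le η (ξ - η)
  have h2 : ‖ξ‖ ^ 2 ≤ (‖η‖ + ‖ξ - η‖) ^ 2 := by gcongr
  nlinarith [sq_nonneg (‖η‖ - ‖ξ - η‖), mul_nonneg (sq_nonneg ‖η‖) (sq_nonneg ‖ξ - η‖)]

/-- Peetre's inequality distributes the weight over the two factors, so the weighted convolution is
dominated by 2^{s/2} times the convolution of the weighted norms. -/
theorem integrable_norm_convolution_mul_rpow (hs : 0 ≤ s) (hhi : Integrable h)
    (hki : Integrable k)
    (hh : Integrable fun ξ => ‖h ξ‖ * (1 + ‖ξ‖ ^ 2) ^ (s / 2))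
    (hk : Integrable fun ξ => ‖k ξ‖ * (1 + ‖ξ‖ ^ 2) ^ (s / 2)) :
    Integrable fun ξ => ‖(h ⋆[ContinuousLinearMap.mul ℂ ℂ] k) ξ‖ * (1 + ‖ξ‖ ^ 2) ^ (s / 2) := by
  have hm : Continuous fun ξ : EuclideanSpace ℝ (Fin d) => (1 + ‖ξ‖ ^ 2) ^ (s / 2) :=
    Continuous.rpow_const (by fun_prop) fun ξ => Or.inr (by positivity)
  have hI := hhi.integrable_convolution (ContinuousLinearMap.mul ℂ ℂ) hki
  refine ((hh.integrable_convolution (ContinuousLinearMap.mul ℝ ℝ) hk).const_mul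
    (2 ^ (s / 2))).mono' (hI.aestronglyMeasurable.norm.mul hm.aestronglyMeasurable) ?_
  filter_upwards [hh.ae_convolution_exists (ContinuousLinearMap.mul ℝ ℝ) hk] with ξ hξ
  rw [Real.norm_of_nonneg (by positivity), mul_comm,
    ← Real.norm_of_nonneg (show 0 ≤ (1 + ‖ξ‖ ^ 2) ^ (s / 2) by positivity), ← norm_smul,
    convolution_def, convolution_def, ← integral_smul, ← integral_const_mul]
  refine norm_integral_le_of_norm_le (hξ.integrable.const_mul _) (Eventually.of_forall fun η => ?_)
  simp only [ContinuousLinearMap.mul_apply', norm_smul, norm_mul]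
  rw [Real.norm_of_nonneg (by positivity)]
  calc (1 + ‖ξ‖ ^ 2) ^ (s / 2) * (‖h η‖ * ‖k (ξ - η)‖)
      ≤ (2 ^ (s / 2) * ((1 + ‖η‖ ^ 2) ^ (s / 2) * (1 + ‖ξ - η‖ ^ 2) ^ (s / 2))) *
        (‖h η‖ * ‖k (ξ - η)‖) := by
        gcongr
        exact one_add_norm_sq_rpow_le hs ξ η
    _ = _ := by ring

end Weight

/-! ### A maximum principle on the whole space -/

section MaximumPrinciple

variable {d : ℕ}

/-- A maximum principle: a continuous function vanishing at infinity, which has second symmetric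
derivatives along the coordinate axes whose sum is nonnegative where the function is positive, is
nonpositive. -/
theorem nonpos_of_sum_second_symmetric_deriv_nonneg (hd : 1 ≤ d)
    {U : EuclideanSpace ℝ (Fin d) → ℝ} (hU : Continuous U)
    (hU0 : Tendsto U (cocompact (EuclideanSpace ℝ (Fin d))) (𝓝 0))
    {D : EuclideanSpace ℝ (Fin d) → Fin d → ℝ}
    (hD : ∀ x i, Tendsto (fun t : ℝ => (U (x + t • EuclideanSpace.single i 1) +
      U (x - t • EuclideanSpace.single i 1) - 2 * U x) / t ^ 2) (𝓝[≠] 0) (𝓝 (D x i)))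
    (hsub : ∀ x, 0 < U x → 0 ≤ ∑ i, D x i) (x₀ : EuclideanSpace ℝ (Fin d)) : U x₀ ≤ 0 := by
  by_contra! hM
  obtain ⟨K, hK, hKU⟩ := mem_cocompact.1 (hU0.eventually_lt_const (half_pos hM))
  obtain ⟨r, hr⟩ := hK.isBounded.subset_ball (0 : EuclideanSpace ℝ (Fin d))
  obtain ⟨R, hR0, hrR, hx₀R⟩ : ∃ R : ℝ, 0 < R ∧ r ≤ R ∧ ‖x₀‖ ≤ R :=
    ⟨max 1 (max r ‖x₀‖), by positivity, by simp, by simp⟩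
  have hout : ∀ x, R ≤ ‖x‖ → U x < U x₀ / 2 := fun x hx => hKU fun hxK => by
    have := hr hxK
    rw [mem_ball_zero_iff] at this
    linarith
  -- The sign condition is not strict, so U is perturbed by ε|x|². On the ball this adds at most
  -- U(x₀)/4, while U < U(x₀)/2 at radius R: the perturbed maximum is interior, and U is still
  -- positive there.
  set ε : ℝ := U x₀ / (4 * R ^ 2) with hε
  have hε0 : 0 < ε := by positivity
  have hεR : ε * R ^ 2 = U x₀ / 4 := by
    rw [hε]; field_simp
  obtain ⟨x₁, hx₁, hmax⟩ := (isCompact_closedBall (0 : EuclideanSpace ℝ (Fin d)) R).exists_isMaxOn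
    (f := fun x => U x + ε * ‖x‖ ^ 2) ⟨x₀, by simpa using hx₀R⟩ (by fun_prop)
  have h1 : U x₀ ≤ U x₁ + ε * ‖x₁‖ ^ 2 := by
    have : U x₀ + ε * ‖x₀‖ ^ 2 ≤ U x₁ + ε * ‖x₁‖ ^ 2 :=
      hmax (by simpa using hx₀R)
    have h2 : 0 ≤ ε * ‖x₀‖ ^ 2 := by positivity
    linarith
  have hx₁R : ‖x₁‖ ≤ R := by simpa using hx₁
  have h2 : ε * ‖x₁‖ ^ 2 ≤ U x₀ / 4 := by
    rw [← hεR]; gcongr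
  have hlt : ‖x₁‖ < R := by
    by_contra! h
    linarith [hout x₁ h]
  have hDle : ∀ i, D x₁ i ≤ -(2 * ε) := by
    intro i
    refine le_of_tendsto (hD x₁ i) ?_
    have hc (c : ℝ) : ∀ᶠ t : ℝ in 𝓝[≠] 0, ‖x₁ + (c * t) • EuclideanSpace.single i (1 : ℝ)‖ < R := by
      have : ContinuousAt (fun t : ℝ => ‖x₁ + (c * t) • EuclideanSpace.single i (1 : ℝ)‖) 0 := by
        fun_prop
      exact nhdsWithin_le_nhds (this.eventually_lt_const (by simpa using hlt))
    filter_upwards [hc 1, hc (-1), self_mem_nhdsWithin] with t ht1 ht2 ht0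
    have ht0 : t ≠ 0 := ht0
    rw [one_mul] at ht1
    rw [neg_one_mul, neg_smul, ← sub_eq_add_neg] at ht2
    have hm1 : U (x₁ + t • EuclideanSpace.single i 1) +
        ε * ‖x₁ + t • EuclideanSpace.single i (1 : ℝ)‖ ^ 2 ≤ U x₁ + ε * ‖x₁‖ ^ 2 :=
      hmax (by simpa using ht1.le)
    have hm2 : U (x₁ - t • EuclideanSpace.single i 1) +
        ε * ‖x₁ - t • EuclideanSpace.single i (1 : ℝ)‖ ^ 2 ≤ U x₁ + ε * ‖x₁‖ ^ 2 :=
      hmax (by simpa using ht2.le)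
    -- The parallelogram law makes the second difference of ε|x|² exactly 2εt².
    have hpar := parallelogram_law_with_norm ℝ x₁ (t • EuclideanSpace.single i (1 : ℝ))
    have hn : ‖t • EuclideanSpace.single i (1 : ℝ)‖ ^ 2 = t ^ 2 := by
      rw [norm_smul]; simp
    rw [div_le_iff₀ (by positivity)]
    have : ε * ‖x₁ + t • EuclideanSpace.single i (1 : ℝ)‖ ^ 2 +
        ε * ‖x₁ - t • EuclideanSpace.single i (1 : ℝ)‖ ^ 2 =
        2 * (ε * ‖x₁‖ ^ 2 + ε * t ^ 2) := by
      rw [← hn]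
      linear_combination ε * hpar
    linarith
  have hsum : ∑ i, D x₁ i ≤ ∑ _i : Fin d, -(2 * ε) := Finset.sum_le_sum fun i _ => hDle i
  rw [Finset.sum_const, Finset.card_univ, Fintype.card_fin, nsmul_eq_mul] at hsum
  -- With at least one axis the sum is at most -2ε < 0, against its sign where U > 0.
  have hd' : (1 : ℝ) ≤ d := by exact_mod_cast hd
  have := hsub x₁ (by linarith)
  nlinarith

end MaximumPrinciple

/-! ### Second symmetric differences under the Fourier integral -/

section SecondDifference

variable {d : ℕ}

/-- By the half-angle formula the quotient is minus the square of the difference quotient at 0 of t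
↦ 2 sin(ta/2), whose derivative there is a. -/
theorem tendsto_two_mul_cos_sub_two_div_sq (a : ℝ) :
    Tendsto (fun t : ℝ => (2 * Real.cos (t * a) - 2) / t ^ 2) (𝓝[≠] 0) (𝓝 (-a ^ 2)) := by
  have h1 : HasDerivAt (fun t : ℝ => 2 * Real.sin (t * a / 2)) a 0 := by
    have := ((((hasDerivAt_id (0 : ℝ)).mul_const a).div_const 2).sin).const_mul 2
    simpa [mul_div_cancel₀] using this
  have h2 := ((hasDerivAt_iff_tendsto_slope_zero.1 h1).pow 2).neg
  refine h2.congr fun t => ?_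
  have h3 : Real.cos (t * a) = 1 - 2 * Real.sin (t * a / 2) ^ 2 := by
    have := Real.cos_two_mul (t * a / 2)
    rw [mul_div_cancel₀ _ two_ne_zero] at this
    rw [this, Real.cos_sq']
    ring
  rw [h3]
  simp
  ring

theorem abs_two_mul_cos_sub_two_le (a : ℝ) : |2 * Real.cos a - 2| ≤ a ^ 2 := by
  rw [abs_le]
  constructor <;> nlinarith [Real.one_sub_sq_div_two_le_cos (x := a), Real.cos_le_one a]

/-- The second symmetric derivative of an inverse Fourier integral in a unit direction. -/
theorem tendsto_second_difference_fourierInvIntegralFun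
    {h : EuclideanSpace ℝ (Fin d) → ℂ} (hh : Integrable h)
    (hh2 : Integrable fun ξ => ((‖ξ‖ ^ 2 : ℝ) : ℂ) * h ξ) (x e : EuclideanSpace ℝ (Fin d))
    (he : ‖e‖ = 1) :
    Tendsto (fun t : ℝ => (fourierInvIntegralFun h (x + t • e) +
        fourierInvIntegralFun h (x - t • e) - 2 * fourierInvIntegralFun h x) / (t : ℂ) ^ 2)
      (𝓝[≠] 0)
      (𝓝 (fourierInvIntegralFun (fun ξ => ((-(inner ℝ e ξ) ^ 2 : ℝ) : ℂ) * h ξ) x)) := by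
  have h1 (t : ℝ) : (fourierInvIntegralFun h (x + t • e) +
        fourierInvIntegralFun h (x - t • e) - 2 * fourierInvIntegralFun h x) / (t : ℂ) ^ 2 =
      ∫ ξ, (((2 * Real.cos (t * inner ℝ e ξ) - 2) / t ^ 2 : ℝ) : ℂ) * h ξ *
        Complex.exp (Complex.I * (inner ℝ x ξ : ℝ)) := by
    simp only [fourierInvIntegralFun]
    have hi := integrable_mul_exp_inner hh
    have hadd : Integrable fun ξ => h ξ * Complex.exp (Complex.I * (inner ℝ (x + t • e) ξ : ℝ)) +
        h ξ * Complex.exp (Complex.I * (inner ℝ (x - t • e) ξ : ℝ)) := (hi _).add (hi _)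
    rw [← integral_add (hi _) (hi _), ← integral_const_mul,
      ← integral_sub hadd ((hi _).const_mul _), ← integral_div]
    congr 1 with ξ
    rw [inner_add_left, inner_sub_left, real_inner_smul_left]
    push_cast
    rw [mul_add, mul_sub, Complex.exp_add, Complex.exp_sub, Complex.two_cos, neg_mul,
      Complex.exp_neg, mul_comm Complex.I ((t : ℂ) * _)]
    field_simp
  simp only [h1]
  -- The domination is |2 cos(tb) - 2| / t² ≤ b² ≤ |ξ|² with b = ⟨e, ξ⟩.
  refine tendsto_integral_filter_of_dominated_convergence
    (fun ξ => ‖((‖ξ‖ ^ 2 : ℝ) : ℂ) * h ξ‖) ?_ ?_ hh2.norm ?_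
  · refine Eventually.of_forall fun t => ?_
    refine AEStronglyMeasurable.mul (AEStronglyMeasurable.mul ?_ hh.aestronglyMeasurable) ?_
    · exact (by fun_prop : Continuous fun ξ : EuclideanSpace ℝ (Fin d) =>
        (((2 * Real.cos (t * inner ℝ e ξ) - 2) / t ^ 2 : ℝ) : ℂ)).aestronglyMeasurable
    · exact (by fun_prop : Continuous _).aestronglyMeasurable
  · filter_upwards [self_mem_nhdsWithin] with t ht
    have ht : t ≠ 0 := ht
    refine Eventually.of_forall fun ξ => ?_
    rw [norm_mul, norm_mul, norm_mul, norm_exp_I_mul_inner, mul_one, Complex.norm_real,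
      Complex.norm_real]
    gcongr
    rw [Real.norm_eq_abs, abs_div, abs_of_nonneg (sq_nonneg t), Real.norm_of_nonneg (by positivity),
      div_le_iff₀ (by positivity)]
    refine (abs_two_mul_cos_sub_two_le _).trans ?_
    rw [mul_pow, mul_comm]
    refine mul_le_mul_of_nonneg_right (sq_le_sq.2 ?_) (sq_nonneg t)
    simpa [he] using abs_real_inner_le_norm e ξ
  · refine Eventually.of_forall fun ξ => ?_
    exact (((Complex.continuous_ofReal.tendsto _).comp
      (tendsto_two_mul_cos_sub_two_div_sq _)).mul_const _).mul_const _

end SecondDifference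

/-! ### Uniqueness for the equation on the Fourier side -/

section Uniqueness

variable {d : ℕ}

/-- The multiplier is bounded by α⁻¹. The weight is left free to cover both plain integrability and
the Barron norm. -/
theorem integrable_norm_div_add_norm_sq_mul {α : ℝ} (hα : 0 < α) {f : EuclideanSpace ℝ (Fin d) → ℂ}
    {w : EuclideanSpace ℝ (Fin d) → ℝ} (hfw : Integrable fun ξ => ‖f ξ‖ * w ξ) :
    Integrable fun ξ => ‖f ξ / ((α + ‖ξ‖ ^ 2 : ℝ) : ℂ)‖ * w ξ := by
  have hc : Continuous fun ξ : EuclideanSpace ℝ (Fin d) => (α + ‖ξ‖ ^ 2)⁻¹ :=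
    Continuous.inv₀ (by fun_prop) fun ξ => by positivity
  refine (hfw.bdd_mul (c := α⁻¹) hc.aestronglyMeasurable (Eventually.of_forall fun ξ => ?_)).congr
    (Eventually.of_forall fun ξ => ?_)
  · rw [Real.norm_of_nonneg (by positivity)]
    gcongr
    nlinarith [sq_nonneg ‖ξ‖]
  · simp only [norm_div, Complex.norm_real]
    rw [Real.norm_of_nonneg (by positivity : 0 ≤ α + ‖ξ‖ ^ 2)]
    ring

theorem nonpos_of_fourier_equation (hd : 1 ≤ d) {α : ℝ}
    {w h : EuclideanSpace ℝ (Fin d) → ℂ} (hw : Integrable w) (hh : Integrable h)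
    (hwim : ∀ x, (fourierInvIntegralFun w x).im = 0)
    (hV : ∀ x, 0 ≤ α + (fourierInvIntegralFun w x).re)
    (heq : ∀ᵐ ξ, ((α + ‖ξ‖ ^ 2 : ℝ) : ℂ) * h ξ + (w ⋆[ContinuousLinearMap.mul ℂ ℂ] h) ξ = 0)
    (x : EuclideanSpace ℝ (Fin d)) : (fourierInvIntegralFun h x).re ≤ 0 := by
  have hk : Integrable (w ⋆[ContinuousLinearMap.mul ℂ ℂ] h) := hw.integrable_convolution _ hh
  -- The equation itself supplies the regularity: it writes |ξ|² h as a combination of integrable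
  -- functions.
  have hae : (fun ξ => -(α : ℂ) * h ξ - (w ⋆[ContinuousLinearMap.mul ℂ ℂ] h) ξ) =ᵐ[volume]
      fun ξ => ((‖ξ‖ ^ 2 : ℝ) : ℂ) * h ξ := by
    filter_upwards [heq] with ξ hξ
    push_cast at hξ ⊢
    linear_combination -hξ
  have hh2 : Integrable fun ξ => ((‖ξ‖ ^ 2 : ℝ) : ℂ) * h ξ :=
    ((hh.const_mul (-(α : ℂ))).sub hk).congr hae
  have hinner (e : EuclideanSpace ℝ (Fin d)) (he : ‖e‖ = 1) :
      Integrable fun ξ => ((-(inner ℝ e ξ) ^ 2 : ℝ) : ℂ) * h ξ := by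
    refine hh2.mono ((by fun_prop : Continuous fun ξ : EuclideanSpace ℝ (Fin d) =>
      ((-(inner ℝ e ξ) ^ 2 : ℝ) : ℂ)).aestronglyMeasurable.mul hh.aestronglyMeasurable)
      (Eventually.of_forall fun ξ => ?_)
    rw [norm_mul, norm_mul, Complex.norm_real, Complex.norm_real, norm_neg, norm_pow, norm_pow,
      norm_norm]
    gcongr
    simpa [he] using abs_real_inner_le_norm e ξ
  have hone (i : Fin d) : ‖EuclideanSpace.single i (1 : ℝ)‖ = 1 := by simp
  refine nonpos_of_sum_second_symmetric_deriv_nonneg hd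
    (U := fun x => (fourierInvIntegralFun h x).re)
    (D := fun x i => (fourierInvIntegralFun (fun ξ =>
      ((-(inner ℝ (EuclideanSpace.single i (1 : ℝ)) ξ) ^ 2 : ℝ) : ℂ) * h ξ) x).re)
    (Complex.continuous_re.comp (continuous_fourierInvIntegralFun hh))
    ((Complex.continuous_re.tendsto 0).comp (tendsto_fourierInvIntegralFun_cocompact h))
    (fun x i => ?_) (fun x hx => ?_) x
  · refine ((Complex.continuous_re.tendsto _).comp
      (tendsto_second_difference_fourierInvIntegralFun hh hh2 x _ (hone i))).congr fun t => ?_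
    rw [Function.comp_apply, ← Complex.ofReal_pow, Complex.div_ofReal_re]
    simp
  · have hsum : ∑ i, fourierInvIntegralFun (fun ξ =>
        ((-(inner ℝ (EuclideanSpace.single i (1 : ℝ)) ξ) ^ 2 : ℝ) : ℂ) * h ξ) x =
        (α + fourierInvIntegralFun w x) * fourierInvIntegralFun h x := by
      have h1 : ∑ i, fourierInvIntegralFun (fun ξ =>
          ((-(inner ℝ (EuclideanSpace.single i (1 : ℝ)) ξ) ^ 2 : ℝ) : ℂ) * h ξ) x =
          fourierInvIntegralFun (fun ξ => (-1) * (((‖ξ‖ ^ 2 : ℝ) : ℂ) * h ξ)) x := by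
        simp only [fourierInvIntegralFun]
        rw [← integral_finsetSum _ fun i _ => integrable_mul_exp_inner (hinner _ (hone i)) x]
        congr 1 with ξ
        rw [← Finset.sum_mul, ← Finset.sum_mul, ← Complex.ofReal_sum, EuclideanSpace.real_norm_sq_eq]
        simp [EuclideanSpace.inner_single_left]
      rw [h1, fourierInvIntegralFun_const_mul, ← fourierInvIntegralFun_congr_ae hae,
        fourierInvIntegralFun_sub (hh.const_mul _) hk, fourierInvIntegralFun_const_mul,
        fourierInvIntegralFun_convolution hw hh]
      ring
    have hre := congrArg Complex.re hsum
    rw [Complex.re_sum] at hre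
    rw [hre, Complex.mul_re]
    simp only [Complex.add_re, Complex.add_im, Complex.ofReal_re, Complex.ofReal_im, hwim,
      add_zero, zero_mul, sub_zero]
    exact mul_nonneg (hV x) hx.le

theorem re_eq_zero_of_fourier_equation (hd : 1 ≤ d) {α : ℝ}
    {w h : EuclideanSpace ℝ (Fin d) → ℂ} (hw : Integrable w) (hh : Integrable h)
    (hwim : ∀ x, (fourierInvIntegralFun w x).im = 0)
    (hV : ∀ x, 0 ≤ α + (fourierInvIntegralFun w x).re)
    (heq : ∀ᵐ ξ, ((α + ‖ξ‖ ^ 2 : ℝ) : ℂ) * h ξ + (w ⋆[ContinuousLinearMap.mul ℂ ℂ] h) ξ = 0)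
    (x : EuclideanSpace ℝ (Fin d)) : (fourierInvIntegralFun h x).re = 0 := by
  refine le_antisymm (nonpos_of_fourier_equation hd hw hh hwim hV heq x) ?_
  -- The equation is linear in h, so the upper bound for -h is the missing lower bound.
  have h1 := nonpos_of_fourier_equation hd (h := (-1 : ℂ) • h) hw (hh.smul (-1 : ℂ)) hwim hV ?_ x
  · have h2 := fourierInvIntegralFun_const_mul (-1) h x
    simp only [Pi.smul_def, smul_eq_mul, h2] at h1
    simpa using h1
  · filter_upwards [heq] with ξ hξ
    rw [convolution_smul]
    simp only [Pi.smul_apply, smul_eq_mul]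
    linear_combination -hξ

end Uniqueness

/-! ### Barron functions, the operator and distributional solutions -/

section Barron

variable {d : ℕ} {s α : ℝ} {W u : EuclideanSpace ℝ (Fin d) →ₘ[volume] ℝ}
  {w h : EuclideanSpace ℝ (Fin d) → ℂ}

theorem isFourierTransform_mul (hw : Integrable w) (hh : Integrable h)
    (hW : IsFourierTransform W w) (hu : IsFourierTransform u h) :
    IsFourierTransform (W * u : EuclideanSpace ℝ (Fin d) →ₘ[volume] ℝ)
      (w ⋆[ContinuousLinearMap.mul ℂ ℂ] h) := by
  rw [isFourierTransform_iff (hw.integrable_convolution _ hh)]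
  filter_upwards [AEEqFun.coeFn_mul W u, (isFourierTransform_iff hw).1 hW,
    (isFourierTransform_iff hh).1 hu] with x h1 h2 h3
  rw [fourierInvIntegralFun_convolution hw hh, ← h2, ← h3, h1, Pi.mul_apply, Complex.ofReal_mul]

theorem integrable_div_add_norm_sq (hα : 0 < α) (hh : Integrable h) :
    Integrable fun ξ => h ξ / ((α + ‖ξ‖ ^ 2 : ℝ) : ℂ) := by
  have hm : Continuous fun ξ : EuclideanSpace ℝ (Fin d) => ((α + ‖ξ‖ ^ 2 : ℝ) : ℂ)⁻¹ := by
    refine Continuous.inv₀ (by fun_prop) fun ξ => ?_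
    have : 0 < α + ‖ξ‖ ^ 2 := by positivity
    exact_mod_cast this.ne'
  have h1 := integrable_norm_div_add_norm_sq_mul (w := fun _ => 1) hα (by simpa using hh.norm)
  simp only [mul_one] at h1
  refine (integrable_norm_iff ?_).1 h1
  simp only [div_eq_mul_inv]
  exact hh.aestronglyMeasurable.mul hm.aestronglyMeasurable

/-- Division by the real even function α + |ξ|² preserves the symmetry h(-ξ)* = h(ξ), so taking the
real part in `resolventFun` loses nothing. -/
theorem isFourierTransform_barronResolvent (hα : 0 < α) (hh : Integrable h)
    (hu : IsFourierTransform u h) :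
    IsFourierTransform (barronResolvent α u) fun ξ => h ξ / ((α + ‖ξ‖ ^ 2 : ℝ) : ℂ) := by
  rw [isFourierTransform_iff (integrable_div_add_norm_sq hα hh)]
  have hconj : (fun ξ => starRingEnd ℂ (h (-ξ) / ((α + ‖-ξ‖ ^ 2 : ℝ) : ℂ))) =ᵐ[volume]
      fun ξ => h ξ / ((α + ‖ξ‖ ^ 2 : ℝ) : ℂ) := by
    filter_upwards [hu.conj_neg_ae_eq hh] with ξ hξ
    rw [map_div₀, Complex.conj_ofReal, hξ, norm_neg]
  have hcongr : (fun ξ => fourierTransformFun u ξ / ((α + ‖ξ‖ ^ 2 : ℝ) : ℂ)) =ᵐ[volume]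
      fun ξ => h ξ / ((α + ‖ξ‖ ^ 2 : ℝ) : ℂ) := by
    filter_upwards [fourierTransformFun_ae_eq hu] with ξ hξ
    rw [hξ]
  filter_upwards [AEEqFun.coeFn_mk _ (aestronglyMeasurable_resolventFun α u)] with x hx
  rw [barronResolvent, hx, resolventFun, fourierInvIntegralFun_congr_ae hcongr]
  exact ofReal_re_fourierInvIntegralFun hconj x

theorem isFourierTransform_barronOperator (hα : 0 < α) (hw : Integrable w) (hh : Integrable h)
    (hW : IsFourierTransform W w) (hu : IsFourierTransform u h) :
    IsFourierTransform (barronOperator α W u)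
      fun ξ => (w ⋆[ContinuousLinearMap.mul ℂ ℂ] h) ξ / ((α + ‖ξ‖ ^ 2 : ℝ) : ℂ) :=
  isFourierTransform_barronResolvent hα (hw.integrable_convolution _ hh)
    (isFourierTransform_mul hw hh hW hu)

theorem isFourierTransform_add {v : EuclideanSpace ℝ (Fin d) →ₘ[volume] ℝ}
    {k : EuclideanSpace ℝ (Fin d) → ℂ} (hh : Integrable h) (hk : Integrable k)
    (hu : IsFourierTransform u h) (hv : IsFourierTransform v k) :
    IsFourierTransform (u + v : EuclideanSpace ℝ (Fin d) →ₘ[volume] ℝ) fun ξ => h ξ + k ξ := by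
  refine (isFourierTransform_iff (hh.add hk)).2 ?_
  filter_upwards [AEEqFun.coeFn_add u v, (isFourierTransform_iff hh).1 hu,
    (isFourierTransform_iff hk).1 hv] with x h1 h2 h3
  change _ = fourierInvIntegralFun (fun ξ => h ξ + k ξ) x
  rw [fourierInvIntegralFun_add hh hk, ← h2, ← h3, h1, Pi.add_apply, Complex.ofReal_add]

/-- If `α + W ≥ 0` and the transforms `w`, `h` satisfy the Fourier side of `(α - Δ + W) u = 0`,
then the inverse Fourier integral of `h` has vanishing real part. -/
theorem re_fourierInvIntegralFun_eq_zero (hd : 1 ≤ d) (hw : Integrable w) (hh : Integrable h)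
    (hW : IsFourierTransform W w) (hV : ∀ᵐ x, 0 ≤ α + W x)
    (heq : ∀ᵐ ξ, ((α + ‖ξ‖ ^ 2 : ℝ) : ℂ) * h ξ + (w ⋆[ContinuousLinearMap.mul ℂ ℂ] h) ξ = 0)
    (x : EuclideanSpace ℝ (Fin d)) : (fourierInvIntegralFun h x).re = 0 := by
  have hcont := continuous_fourierInvIntegralFun hw
  refine re_eq_zero_of_fourier_equation hd hw hh
    (fourierInvIntegralFun_im_eq_zero (hW.conj_neg_ae_eq hw)) (fun y => ?_) heq x
  -- The sign is known only almost everywhere, but a closed set of full measure is everything.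
  have hdense : Dense {y | 0 ≤ α + (fourierInvIntegralFun w y).re} := by
    refine Measure.dense_of_ae (μ := volume) ?_
    filter_upwards [hV, (isFourierTransform_iff hw).1 hW] with y h1 h2
    rwa [← h2, Complex.ofReal_re]
  have hclosed : IsClosed {y | 0 ≤ α + (fourierInvIntegralFun w y).re} :=
    isClosed_le continuous_const (continuous_const.add (Complex.continuous_re.comp hcont))
  exact hclosed.closure_subset (hdense y)

theorem barron_eq_zero (hd : 1 ≤ d) (hw : Integrable w) (hh : Integrable h)
    (hW : IsFourierTransform W w) (hu : IsFourierTransform u h) (hV : ∀ᵐ x, 0 ≤ α + W x)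
    (heq : ∀ᵐ ξ, ((α + ‖ξ‖ ^ 2 : ℝ) : ℂ) * h ξ + (w ⋆[ContinuousLinearMap.mul ℂ ℂ] h) ξ = 0) :
    u = 0 := by
  refine AEEqFun.ext ?_
  filter_upwards [(isFourierTransform_iff hh).1 hu, AEEqFun.coeFn_zero (α := EuclideanSpace ℝ
    (Fin d)) (μ := volume) (β := ℝ)] with x h1 h2
  rw [h2, Pi.zero_apply, ← Complex.ofReal_re (u x), h1]
  exact re_fourierInvIntegralFun_eq_zero hd hw hh hW hV heq x

theorem add_barronOperator_mem (hs : 0 ≤ s) (hα : 0 < α) (hW : W ∈ spectralBarronSpace d s)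
    (hu : u ∈ spectralBarronSpace d s) :
    u + barronOperator α W u ∈ spectralBarronSpace d s := by
  obtain ⟨w, hWw, hw⟩ := hW
  obtain ⟨h, huh, hh⟩ := hu
  have hwi := integrable_of_integrable_norm_mul_rpow hs hWw.aestronglyMeasurable hw
  have hhi := integrable_of_integrable_norm_mul_rpow hs huh.aestronglyMeasurable hh
  have hki := hwi.integrable_convolution (ContinuousLinearMap.mul ℂ ℂ) hhi
  have hk := integrable_norm_convolution_mul_rpow hs hwi hhi hw hh
  have hri := integrable_div_add_norm_sq hα hki
  have hc : Continuous fun ξ : EuclideanSpace ℝ (Fin d) => (1 + ‖ξ‖ ^ 2) ^ (s / 2) :=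
    Continuous.rpow_const (by fun_prop) fun ξ => Or.inr (by positivity)
  have hr := integrable_norm_div_add_norm_sq_mul hα hk
  refine ⟨_, isFourierTransform_add hhi hri huh
    (isFourierTransform_barronOperator hα hwi hhi hWw huh), ?_⟩
  refine (hh.add hr).mono' ((hhi.add hri).aestronglyMeasurable.norm.mul hc.aestronglyMeasurable)
    (Eventually.of_forall fun ξ => ?_)
  rw [Real.norm_of_nonneg (by positivity), Pi.add_apply, ← add_mul]
  gcongr
  exact norm_add_le _ _

/-- The difference is taken between transforms, where convolution is visibly bilinear, so linearity
of `barronOperator` is never needed. -/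
theorem injOn_add_barronOperator (hd : 1 ≤ d) (hs : 0 ≤ s) (hα : 0 < α)
    (hW : W ∈ spectralBarronSpace d s) (hV : ∀ᵐ x, 0 ≤ α + W x) :
    InjOn (fun u => u + barronOperator α W u) (spectralBarronSpace d s) := by
  rintro u ⟨h, huh, hh⟩ v ⟨k, hvk, hk⟩ huv
  obtain ⟨w, hWw, hw⟩ := hW
  have hwi := integrable_of_integrable_norm_mul_rpow hs hWw.aestronglyMeasurable hw
  have hhi := integrable_of_integrable_norm_mul_rpow hs huh.aestronglyMeasurable hh
  have hki := integrable_of_integrable_norm_mul_rpow hs hvk.aestronglyMeasurable hk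
  have h1 := isFourierTransform_add hhi
    (integrable_div_add_norm_sq hα (hwi.integrable_convolution _ hhi)) huh
    (isFourierTransform_barronOperator hα hwi hhi hWw huh)
  have h2 := isFourierTransform_add hki
    (integrable_div_add_norm_sq hα (hwi.integrable_convolution _ hki)) hvk
    (isFourierTransform_barronOperator hα hwi hki hWw hvk)
  have huv : u + barronOperator α W u = v + barronOperator α W v := huv
  rw [huv] at h1
  have hneg : Integrable ((-1 : ℂ) • k) := hki.smul (-1 : ℂ)
  have heq : ∀ᵐ ξ, ((α + ‖ξ‖ ^ 2 : ℝ) : ℂ) * (h + (-1 : ℂ) • k) ξ +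
      (w ⋆[ContinuousLinearMap.mul ℂ ℂ] (h + (-1 : ℂ) • k)) ξ = 0 := by
    filter_upwards [h1.ae_eq h2, hwi.ae_convolution_exists (ContinuousLinearMap.mul ℂ ℂ) hhi,
      hwi.ae_convolution_exists (ContinuousLinearMap.mul ℂ ℂ) hneg] with ξ h3 h4 h5
    rw [h4.distrib_add h5, convolution_smul]
    simp only [Pi.add_apply, Pi.smul_apply, smul_eq_mul]
    have h6 : ((α + ‖ξ‖ ^ 2 : ℝ) : ℂ) ≠ 0 := by
      have : 0 < α + ‖ξ‖ ^ 2 := by positivity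
      exact_mod_cast this.ne'
    field_simp at h3
    linear_combination h3
  refine AEEqFun.ext ?_
  filter_upwards [(isFourierTransform_iff hhi).1 huh, (isFourierTransform_iff hki).1 hvk]
    with x h3 h4
  have h5 := re_fourierInvIntegralFun_eq_zero hd hwi (hhi.add hneg) hWw hV heq x
  have h6 := fourierInvIntegralFun_add hhi hneg x
  have h7 := fourierInvIntegralFun_const_mul (-1) k x
  simp only [Pi.add_def, Pi.smul_def, smul_eq_mul] at h5 h6
  rw [h6, h7, ← h3, ← h4] at h5
  simp at h5
  linarith

/-- Moving the test function through Fubini turns -Δ into |ξ|² and V into α plus convolution by w.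
The resulting function m annihilates every Schwartz function, hence vanishes a.e. -/
theorem fourier_equation_of_isDistributionalSolution {V : EuclideanSpace ℝ (Fin d) → ℝ}
    (hw : Integrable w) (hh : Integrable h) (hW : IsFourierTransform W w)
    (hu : IsFourierTransform u h) (hV : V =ᵐ[volume] fun x => α + W x)
    (hsol : IsDistributionalSolution V u) :
    ∀ᵐ ξ, ((α + ‖ξ‖ ^ 2 : ℝ) : ℂ) * h ξ + (w ⋆[ContinuousLinearMap.mul ℂ ℂ] h) ξ = 0 := by
  set k := w ⋆[ContinuousLinearMap.mul ℂ ℂ] h with hk_def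
  have hk : Integrable k := hw.integrable_convolution _ hh
  have hu' := (isFourierTransform_iff hh).1 hu
  have hW' := (isFourierTransform_iff hw).1 hW
  set m : EuclideanSpace ℝ (Fin d) → ℂ := fun ξ => ((α + ‖ξ‖ ^ 2 : ℝ) : ℂ) * h ξ + k ξ
  have hsq (φ : 𝓢(EuclideanSpace ℝ (Fin d), ℂ)) :
      Integrable fun ξ => h ξ * ((‖ξ‖ ^ 2 : ℝ) * φ ξ) := by
    have hg : (fun x : EuclideanSpace ℝ (Fin d) => ‖x‖ ^ 2).HasTemperateGrowth := by fun_prop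
    refine (integrable_mul_schwartz hh (SchwartzMap.smulLeftCLM ℂ
      (fun x : EuclideanSpace ℝ (Fin d) => ‖x‖ ^ 2) φ)).congr (Eventually.of_forall fun ξ => ?_)
    simp only [SchwartzMap.smulLeftCLM_apply_apply hg, Complex.real_smul]
  have hsplit (φ : EuclideanSpace ℝ (Fin d) → ℂ) : (fun ξ => m ξ * φ ξ) = fun ξ =>
      h ξ * ((‖ξ‖ ^ 2 : ℝ) * φ ξ) + (α * (h ξ * φ ξ) + k ξ * φ ξ) := by
    ext ξ
    simp only [m]
    push_cast
    ring
  have hrest (φ : 𝓢(EuclideanSpace ℝ (Fin d), ℂ)) :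
      Integrable fun ξ => α * (h ξ * φ ξ) + k ξ * φ ξ :=
    ((integrable_mul_schwartz hh φ).const_mul _).add (integrable_mul_schwartz hk φ)
  have hm (φ : 𝓢(EuclideanSpace ℝ (Fin d), ℂ)) : Integrable fun ξ => m ξ * φ ξ := by
    rw [hsplit]
    exact (hsq φ).add (hrest φ)
  have hreal (φ : 𝓢(EuclideanSpace ℝ (Fin d), ℝ)) :
      ∫ ξ, m ξ * fourierInvIntegralFun (fun x => (φ x : ℂ)) ξ = 0 := by
    let φc : 𝓢(EuclideanSpace ℝ (Fin d), ℂ) := SchwartzMap.postcompCLM Complex.ofRealCLM φ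
    have hφc : (φc : EuclideanSpace ℝ (Fin d) → ℂ) = fun x => (φ x : ℂ) := rfl
    have hΔ (x) : (Δ φc) x = ((Δ φ) x : ℂ) := by
      rw [SchwartzMap.laplacian_apply, SchwartzMap.laplacian_apply]
      exact ((φ.smooth 2).contDiffAt.laplacian_CLM_comp_left (l := Complex.ofRealCLM))
    obtain ⟨ψ, hψ⟩ := exists_schwartz_fourierInvIntegralFun φc
    rw [← hφc, ← funext hψ, hsplit, integral_add (hsq ψ) (hrest ψ), integral_add
      ((integrable_mul_schwartz hh ψ).const_mul _) (integrable_mul_schwartz hk ψ),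
      integral_const_mul]
    have e1 : ∫ ξ, h ξ * ((‖ξ‖ ^ 2 : ℝ) * ψ ξ) = ((-∫ x, u x * (Δ φ) x : ℝ) : ℂ) := by
      have h1 := integral_fourierInvIntegralFun_mul hh (Δ φc).integrable
      simp only [fourierInvIntegralFun_laplacian, ← hψ] at h1
      rw [Complex.ofReal_neg, ← integral_complex_ofReal, ← neg_eq_iff_eq_neg, ← integral_neg]
      simp only [neg_mul, mul_neg] at h1
      rw [← h1]
      refine integral_congr_ae ?_
      filter_upwards [hu'] with x hx
      rw [← hx, hΔ, Complex.ofReal_mul]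
    have e2 : ∫ x, ((V x * u x * φ x : ℝ) : ℂ) =
        α * (∫ ξ, h ξ * ψ ξ) + ∫ ξ, k ξ * ψ ξ := by
      rw [funext hψ, ← integral_fourierInvIntegralFun_mul hh φc.integrable,
        ← integral_fourierInvIntegralFun_mul hk φc.integrable, ← integral_const_mul,
        ← integral_add ((integrable_fourierInvIntegralFun_mul hh φc.integrable).const_mul _)
        (integrable_fourierInvIntegralFun_mul hk φc.integrable)]
      refine integral_congr_ae ?_
      filter_upwards [hu', hW', hV] with x h1 h2 h3
      rw [hk_def, fourierInvIntegralFun_convolution hw hh, ← h1, ← h2, h3, hφc]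
      push_cast
      ring
    rw [e1, ← e2, integral_complex_ofReal, ← Complex.ofReal_add, hsol φ, Complex.ofReal_zero]
  have hzero (φ : 𝓢(EuclideanSpace ℝ (Fin d), ℂ)) : ∫ ξ, m ξ * φ ξ = 0 := by
    obtain ⟨ψ, hψ⟩ := exists_schwartz_fourierIntegralFun φ
    -- The equation is tested on real functions only, so the complex ψ is split into real and
    -- imaginary parts before inverting.
    let ρ : 𝓢(EuclideanSpace ℝ (Fin d), ℝ) := SchwartzMap.postcompCLM Complex.reCLM ψ
    let ι : 𝓢(EuclideanSpace ℝ (Fin d), ℝ) := SchwartzMap.postcompCLM Complex.imCLM ψ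
    have hint (θ : 𝓢(EuclideanSpace ℝ (Fin d), ℝ)) :
        Integrable fun ξ => m ξ * fourierInvIntegralFun (fun x => (θ x : ℂ)) ξ := by
      obtain ⟨χ, hχ⟩ := exists_schwartz_fourierInvIntegralFun
        (SchwartzMap.postcompCLM Complex.ofRealCLM θ)
      have := hm χ
      rwa [funext hχ] at this
    have hof (θ : 𝓢(EuclideanSpace ℝ (Fin d), ℝ)) : Integrable fun x => (θ x : ℂ) :=
      (SchwartzMap.postcompCLM Complex.ofRealCLM θ).integrable
    have hdec (ξ) : φ ξ = fourierInvIntegralFun (fun x => (ρ x : ℂ)) ξ +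
        Complex.I * fourierInvIntegralFun (fun x => (ι x : ℂ)) ξ := by
      rw [← fourierInvIntegralFun_const_mul, ← fourierInvIntegralFun_add (hof ρ)
        ((hof ι).const_mul _), ← fourierInvIntegralFun_fourierIntegralFun φ,
        ← funext hψ]
      congr 1 with x
      rw [mul_comm]
      exact (Complex.re_add_im _).symm
    simp only [hdec, mul_add, mul_left_comm _ Complex.I]
    rw [integral_add (hint ρ) ((hint ι).const_mul _), integral_const_mul, hreal, hreal]
    simp
  have h0 := ae_eq_of_forall_integral_mul_schwartz_eq (g := fun _ => 0) hm (by simp)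
    (by simpa using hzero)
  exact h0

end Barron

theorem proposition3p3 (d : ℕ) (hd : 1 ≤ d) (s : ℝ) (hs : 0 ≤ s) (α : ℝ) (hα : 0 < α)
    (W : EuclideanSpace ℝ (Fin d) →ₘ[volume] ℝ) (hW : W ∈ spectralBarronSpace d s)
    (V : EuclideanSpace ℝ (Fin d) → ℝ) (hV_nonneg : ∀ x, 0 ≤ V x)
    (hV : V =ᵐ[volume] fun x => α + W x) :
    MapsTo (fun u => u + barronOperator α W u) (spectralBarronSpace d s)
        (spectralBarronSpace d s) ∧
      InjOn (fun u => u + barronOperator α W u) (spectralBarronSpace d s) ∧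
      ∀ u ∈ spectralBarronSpace d s, IsDistributionalSolution V u ↔ u = 0 := by
  have hV' : ∀ᵐ x, 0 ≤ α + W x := by
    filter_upwards [hV] with x hx
    exact hx ▸ hV_nonneg x
  refine ⟨fun u hu => add_barronOperator_mem hs hα hW hu,
    injOn_add_barronOperator hd hs hα hW hV', fun u hu => ⟨fun hsol => ?_, ?_⟩⟩
  · obtain ⟨w, hWw, hw⟩ := hW
    obtain ⟨h, huh, hh⟩ := hu
    have hwi := integrable_of_integrable_norm_mul_rpow hs hWw.aestronglyMeasurable hw
    have hhi := integrable_of_integrable_norm_mul_rpow hs huh.aestronglyMeasurable hh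
    exact barron_eq_zero hd hwi hhi hWw huh hV'
      (fourier_equation_of_isDistributionalSolution hwi hhi hWw huh hV hsol)
  · rintro rfl φ
    have h0 := AEEqFun.coeFn_zero (α := EuclideanSpace ℝ (Fin d)) (μ := volume) (β := ℝ)
    have h1 : ∫ x, (0 : EuclideanSpace ℝ (Fin d) →ₘ[volume] ℝ) x * (Δ φ) x = 0 := by
      refine integral_eq_zero_of_ae ?_
      filter_upwards [h0] with x hx
      simp [hx]
    have h2 : ∫ x, V x * (0 : EuclideanSpace ℝ (Fin d) →ₘ[volume] ℝ) x * φ x = 0 := by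
      refine integral_eq_zero_of_ae ?_
      filter_upwards [h0] with x hx
      simp [hx]
    rw [h1, h2]
    simp
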